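/- A ribbon graph is a surface with boundary decomposed into vertex discs and edge ribbons; for a ribbon graph $G$ with edge set $E(G)$ let $\varepsilon(G)=2k(G)-\bigl(v(G)-e(G)+f(G)\bigr)$ be its Euler genus, where $k,v,e,f$ are the numbers of connected components, vertices, edges and boundary components. For $A\subseteq E(G)$ let $G^{A}$ be the partial dual of $G$ with respect to $A$ (on every ribbon in $A$ the two arcs along which it is attached to vertex discs are exchanged with its two free sides), and let $${}^{\partial}\varepsilon_{G}(z)=\sum_{A\subseteq E(G)}z^{\varepsilon(G^{A})}$$ be the partial-dual Euler genus polynomial of $G$. A bouquet is a ribbon graph with exactly one vertex; its signed rotation is the cyclic order of the half-edges at the vertex, where the two half-edges of a loop carry equal signs if the loop is untwisted and different signs if it is twisted (the sign $+$ is omitted). A polynomial is called interpolating if the set of exponents of its terms with nonzero coefficient is an interval of integers. For $n\ge 1$ let $B_{2n+1}$ be the bouquet with signed rotation $$(1,2,3,\dots,2n,2n+1,-1,2n,2n+1,2n-2,2n-1,\dots,4,5,2,3).$$ Then $${}^{\partial}\varepsilon_{B_{2n+1}}(z)=2^{n+1}z^{2n+1}+\sum_{s=1}^{n}2^{n+1}\binom{n}{s}z^{2n-2s+2}.$$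 Moreover, for every $n\ge 2$ the ribbon graph $B_{2n+1}$ is non-orientable, the coefficient of $z^{2n-1}$ in ${}^{\partial}\varepsilon_{B_{2n+1}}(z)$ is zero, and ${}^{\partial}\varepsilon_{B_{2n+1}}(z)$ is not interpolating. Thus $B_{2n+1}$ is a counterexample to the conjecture that the partial-dual Euler genus polynomial of every non-orientable ribbon graph is interpolating. -/

import Mathlib

open Polynomial

/-- A ribbon graph with edge set `E`. Every edge-ribbon `e` is a rectangle, attached to the vertex
discs along its two ends. Its four corners ("flags") are the triples `(e, i, s)`: the corner at the
end `i` on the side `s`. The attaching arc at the end `i` joins `(e, i, false)` to `(e, i, true)`;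
the free side `s` joins `(e, false, s)` to `(e, true, s)`. What is left of the boundaries of the
vertex discs that meet at least one ribbon is a set of disjoint arcs whose end points are the flags;
`corner` sends a flag to the other end point of the arc starting there. The number of vertex discs
that meet no ribbon is `isolated`. -/
structure RibbonGraph (E : Type*) where
  corner : E × Bool × Bool → E × Bool × Bool
  corner_involutive : Function.Involutive corner
  corner_ne : ∀ x, corner x ≠ x
  isolated : ℕ

namespace RibbonGraph

variable {E : Type*}

/-- The other corner at the same end of the same ribbon (along the attaching arc). -/
def across (x : E × Bool × Bool) : E × Bool × Bool := (x.1, x.2.1, !x.2.2)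

/-- The other corner on the same side of the same ribbon (along the free side). -/
def along (x : E × Bool × Bool) : E × Bool × Bool := (x.1, !x.2.1, x.2.2)

/-- Number of vertices: a boundary of a vertex disc alternates between attaching arcs and corner
arcs. -/
noncomputable def numVertices (G : RibbonGraph E) : ℕ :=
  Nat.card (Quot fun x y : E × Bool × Bool => y = across x ∨ y = G.corner x) + G.isolated

/-- Number of boundary components: such a component alternates between free sides of ribbons and
corner arcs. -/
noncomputable def numFaces (G : RibbonGraph E) : ℕ :=
  Nat.card (Quot fun x y : E × Bool × Bool => y = along x ∨ y = G.corner x) + G.isolated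

/-- Number of connected components. -/
noncomputable def numComponents (G : RibbonGraph E) : ℕ :=
  Nat.card (Quot fun x y : E × Bool × Bool => y = across x ∨ y = along x ∨ y = G.corner x)
    + G.isolated

/-- The Euler genus `ε(G) = 2 k(G) - (v(G) - e(G) + f(G))` (always a non-negative integer). -/
noncomputable def eulerGenus (G : RibbonGraph E) : ℕ :=
  (2 * (G.numComponents : ℤ) - ((G.numVertices : ℤ) - (Nat.card E : ℤ) + (G.numFaces : ℤ))).toNat

/-- A ribbon graph is orientable when its flags can be 2-coloured so that the two end points of every
attaching arc, free side and corner arc get different colours. -/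
def Orientable (G : RibbonGraph E) : Prop :=
  ∃ c : E × Bool × Bool → Bool, ∀ x,
    c (across x) = !c x ∧ c (along x) = !c x ∧ c (G.corner x) = !c x

/-- Exchange the roles of ends and sides on the ribbons in `A`. -/
def exchange [DecidableEq E] (A : Finset E) (x : E × Bool × Bool) : E × Bool × Bool :=
  if x.1 ∈ A then (x.1, x.2.2, x.2.1) else x

theorem exchange_exchange [DecidableEq E] (A : Finset E) (x : E × Bool × Bool) :
    exchange A (exchange A x) = x := by
  by_cases h : x.1 ∈ A <;> simp [exchange, h]

/-- The partial dual `G^A`: on the ribbons in `A` the attaching arcs become free sides and the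
free sides become attaching arcs; the corner arcs stay. Hence the vertices of `G^A` are bounded by
the boundary components of the spanning ribbon subgraph with edge set `A`. -/
def partialDual [DecidableEq E] (G : RibbonGraph E) (A : Finset E) : RibbonGraph E where
  corner x := exchange A (G.corner (exchange A x))
  corner_involutive x := by
    simp [exchange_exchange, G.corner_involutive (exchange A x)]
  corner_ne x h := by
    apply G.corner_ne (exchange A x)
    have := congrArg (exchange A) h
    simpa [exchange_exchange] using this
  isolated := G.isolated

/-- The partial-dual Euler genus polynomial. -/
noncomputable def partialDualEulerGenusPoly [Fintype E] [DecidableEq E] (G : RibbonGraph E) :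
    ℤ[X] :=
  ∑ A : Finset E, X ^ (G.partialDual A).eulerGenus

end RibbonGraph

/-- A polynomial is interpolating when the exponents of its nonzero terms form an interval of
integers. -/
def IsInterpolating (p : ℤ[X]) : Prop :=
  ∀ i j k : ℕ, i ≤ j → j ≤ k → p.coeff i ≠ 0 → p.coeff k ≠ 0 → p.coeff j ≠ 0

/-- A signed rotation: a cyclic ordering of the half-edges `(e, i)`, `i : Bool`, of the loops `e : E`,
given by a list in which each half-edge occurs once, with a sign on each half-edge (`neg h = true`
when `h` carries the sign `-`). -/
structure SignedRotation (E : Type*) where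
  halfEdges : List (E × Bool)
  nodup : halfEdges.Nodup
  mem : ∀ h, h ∈ halfEdges
  neg : E × Bool → Bool

namespace SignedRotation

variable {E : Type*}

/-- Going once around the vertex in the direction of the rotation, the half-edge `h` is entered at its
corner on the side `entry h` and left at its corner on the other side. If the two half-edges of a
loop carry the same sign, the two ends are entered on different sides of the ribbon, so the loop is an
annulus (untwisted); if the signs differ, both are entered on the same side and the loop is a Möbius
band (twisted). -/
def entry (R : SignedRotation E) (h : E × Bool) : Bool := xor h.2 (R.neg h)

/-- The bouquet (one-vertex ribbon graph) with a given signed rotation: corner arcs run from the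
exit corner of each half-edge to the entry corner of the next one. -/
def bouquet [Fintype E] [DecidableEq E] (R : SignedRotation E) : RibbonGraph E where
  corner x :=
    if x.2.2 = R.entry (x.1, x.2.1) then
      let h := R.halfEdges.formPerm⁻¹ (x.1, x.2.1)
      (h.1, h.2, !R.entry h)
    else
      let h := R.halfEdges.formPerm (x.1, x.2.1)
      (h.1, h.2, R.entry h)
  corner_involutive := by
    rintro ⟨e, i, s⟩
    by_cases h : s = R.entry (e, i)
    · simp [h]
    · have h2 : s = !R.entry (e, i) := by
        cases s <;> cases h3 : R.entry (e, i) <;> simp_all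
      simp [h2]
  corner_ne := by
    rintro ⟨e, i, s⟩ h
    by_cases hs : s = R.entry (e, i)
    · simp only [hs, if_true, Prod.mk.injEq] at h
      obtain ⟨h1, h2, h3⟩ := h
      have h4 : R.halfEdges.formPerm⁻¹ (e, i) = (e, i) := Prod.ext h1 h2
      rw [h4] at h3
      simp at h3
    · simp only [hs, if_false, Prod.mk.injEq] at h
      obtain ⟨h1, h2, h3⟩ := h
      have h4 : R.halfEdges.formPerm (e, i) = (e, i) := Prod.ext h1 h2
      rw [h4] at h3
      exact hs h3.symm
  isolated := if Fintype.card E = 0 then 1 else 0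

end SignedRotation

/-- The half-edges of `B_{2n+1}` in the cyclic order `1, 2, …, 2n+1, 1, 2n, 2n+1, …, 4, 5, 2, 3`. The
loop labelled `j` is the element `j - 1` of `Fin (2 * n + 1)`, and `(e, false)`, `(e, true)` are the
first and the second occurrence of `e`. -/
def halfEdgesB (n : ℕ) : List (Fin (2 * n + 1) × Bool) :=
  (List.finRange (2 * n + 1)).map (fun e => (e, false)) ++
    (0, true) ::
      (List.finRange n).reverse.flatMap fun i =>
        [(⟨2 * i.val + 1, by omega⟩, true), (⟨2 * i.val + 2, by omega⟩, true)]

/-- The signed rotation `(1, 2, 3, …, 2n, 2n+1, -1, 2n, 2n+1, …, 4, 5, 2, 3)`. -/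
def rotationB (n : ℕ) : SignedRotation (Fin (2 * n + 1)) where
  halfEdges := halfEdgesB n
  nodup := by
    rw [halfEdgesB, List.nodup_append, List.nodup_cons, List.nodup_flatMap]
    refine ⟨(List.nodup_finRange _).map fun a b h => by simpa using h, ⟨?_, ?_, ?_⟩, ?_⟩
    · simp [Fin.ext_iff]
    · intro i _
      simp
    · refine (List.nodup_reverse.2 (List.nodup_finRange n)).imp ?_
      intro i j hij
      have : i.val ≠ j.val := fun h => hij (Fin.ext h)
      simp [Function.onFun, List.disjoint_left]
      omega
    · rintro ⟨a, b⟩ ha ⟨c, d⟩ hc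
      simp at ha hc
      rintro ⟨⟩
      grind
  mem := by
    rintro ⟨⟨j, hj⟩, b⟩
    cases b
    · simp [halfEdgesB]
    · rcases Nat.eq_zero_or_pos j with rfl | hpos
      · simp [halfEdgesB]
      · simp only [halfEdgesB, List.mem_append, List.mem_cons, List.mem_flatMap, List.mem_reverse]
        refine Or.inr (Or.inr ⟨⟨(j - 1) / 2, by omega⟩, List.mem_finRange _, ?_⟩)
        rcases Nat.mod_two_eq_zero_or_one (j - 1) with h | h
        · left
          simp only [Prod.mk.injEq, Fin.mk.injEq, and_true]
          omega
        · right; left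
          simp only [Prod.mk.injEq, Fin.mk.injEq, and_true]
          omega
  neg h := decide (h = (0, true))

/-- The bouquet `B_{2n+1}`. -/
def bouquetB (n : ℕ) : RibbonGraph (Fin (2 * n + 1)) := (rotationB n).bouquet

/-! Vertices of `G^A` are the curves that follow corner arcs and run along the free sides of ribbons
in `A` and the attaching arcs of the others; faces of `G^A` are the same for the complement of `A`.
Components do not change. So one curve count, `card_quot_sideStep`, gives the Euler genus of every
partial dual.

For `B_{2n+1}` the loops other than `0` form `n` interlaced pairs `2i+1`, `2i+2`, stacked between a
left channel (first half-edges) and a right channel (second half-edges). If both or neither of a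
pair is selected, the two channels pass straight through; if exactly one is, they turn back on
either side of the pair (`pair_cases`). With `t` split pairs the channels fall into levels `0, …,
t`. If loop `0` is not selected, the ends close up and there are `t + 1` curves. If it is, its
twisted ribbon glues level `0` to level `t` and leaves `max t 1` curves.

Complementing `A` keeps `t` and flips the state of loop `0`, so `v + f = (t + 1) + max t 1` whatever
`A` does at loop `0`. The genus is therefore `2n + 1` for `t = 0` and `2n - 2t + 2` for `t ≥ 1`, and
`2^(n+1) * choose n t` sets have `t` split pairs. The only odd exponent is `2n + 1`, which leaves
the gap at `2n - 1`. -/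

/-! ### Cyclic successors of the half-edges -/

theorem List.formPerm_apply_of_getElem? {α : Type*} [DecidableEq α] {l : List α} (hl : l.Nodup)
    {j : ℕ} {x y : α} (hx : l[j]? = some x) (hy : l[(j + 1) % l.length]? = some y) :
    l.formPerm x = y := by
  obtain ⟨hj, rfl⟩ := List.getElem?_eq_some_iff.1 hx
  obtain ⟨hj', rfl⟩ := List.getElem?_eq_some_iff.1 hy
  exact List.formPerm_apply_getElem l hl j hj

theorem List.getElem?_flatMap_pair {α β : Type*} (f g : α → β) (l : List α) (k : ℕ) :
    (l.flatMap fun i => [f i, g i])[2 * k]? = l[k]?.map f ∧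
      (l.flatMap fun i => [f i, g i])[2 * k + 1]? = l[k]?.map g := by
  induction l generalizing k with
  | nil => simp
  | cons a l ih =>
    cases k with
    | zero => simp
    | succ k =>
      have h := ih k
      simp only [List.flatMap_cons, List.cons_append, List.nil_append, Nat.mul_add, Nat.mul_one,
        List.getElem?_cons_succ]
      exact h

theorem nodup_halfEdgesB (n : ℕ) : (halfEdgesB n).Nodup := (rotationB n).nodup

theorem length_halfEdgesB (n : ℕ) : (halfEdgesB n).length = 4 * n + 2 := by
  simp [halfEdgesB, List.length_flatMap]
  ring

theorem halfEdgesB_getElem?_false (n j : ℕ) (hj : j < 2 * n + 1) :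
    (halfEdgesB n)[j]? = some (⟨j, hj⟩, false) := by
  rw [halfEdgesB, List.getElem?_append_left (by simpa using hj)]
  simp [hj]

theorem halfEdgesB_getElem?_zero_true (n : ℕ) :
    (halfEdgesB n)[2 * n + 1]? = some (0, true) := by
  rw [halfEdgesB, List.getElem?_append_right (by simp)]
  simp

/-- The second half-edges of the pairs start at position `2n + 2` in reverse order, so pair `i`
starts at `2n + 2 + 2(n - 1 - i) = 4n - 2i`. -/
theorem halfEdgesB_getElem?_odd (n i : ℕ) (hi : i < n) :
    (halfEdgesB n)[4 * n - 2 * i]? = some (⟨2 * i + 1, by omega⟩, true) := by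
  rw [halfEdgesB, List.getElem?_append_right (by simp; omega)]
  have e : 4 * n - 2 * i - (List.map (fun e => (e, false)) (List.finRange (2 * n + 1))).length
      = 2 * (n - 1 - i) + 1 := by simp; omega
  have e' : n - 1 - (n - 1 - i) = i := by omega
  rw [e, List.getElem?_cons_succ, (List.getElem?_flatMap_pair _ _ _ _).1,
    List.getElem?_reverse (by simp; omega)]
  simp [e', hi]

theorem halfEdgesB_getElem?_even (n i : ℕ) (hi : i < n) :
    (halfEdgesB n)[4 * n - 2 * i + 1]? = some (⟨2 * i + 2, by omega⟩, true) := by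
  rw [halfEdgesB, List.getElem?_append_right (by simp; omega)]
  have e : 4 * n - 2 * i + 1 - (List.map (fun e => (e, false)) (List.finRange (2 * n + 1))).length
      = 2 * (n - 1 - i) + 1 + 1 := by simp; omega
  have e' : n - 1 - (n - 1 - i) = i := by omega
  rw [e, List.getElem?_cons_succ, (List.getElem?_flatMap_pair _ _ _ _).2,
    List.getElem?_reverse (by simp; omega)]
  simp [e', hi]

section Successor

variable (n : ℕ)

theorem formPerm_halfEdgesB_false (j : ℕ) (hj : j < 2 * n) :
    (halfEdgesB n).formPerm (⟨j, by omega⟩, false) = (⟨j + 1, by omega⟩, false) := by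
  refine List.formPerm_apply_of_getElem? (nodup_halfEdgesB n)
    (halfEdgesB_getElem?_false n j (by omega)) ?_
  rw [length_halfEdgesB, Nat.mod_eq_of_lt (by omega)]
  exact halfEdgesB_getElem?_false n _ _

theorem formPerm_halfEdgesB_last_false :
    (halfEdgesB n).formPerm (⟨2 * n, by omega⟩, false) = (0, true) := by
  refine List.formPerm_apply_of_getElem? (nodup_halfEdgesB n)
    (halfEdgesB_getElem?_false n _ (by omega)) ?_
  rw [length_halfEdgesB, Nat.mod_eq_of_lt (by omega)]
  exact halfEdgesB_getElem?_zero_true n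

theorem formPerm_halfEdgesB_zero_true (hn : 1 ≤ n) :
    (halfEdgesB n).formPerm (0, true) = (⟨2 * (n - 1) + 1, by omega⟩, true) := by
  refine List.formPerm_apply_of_getElem? (nodup_halfEdgesB n)
    (halfEdgesB_getElem?_zero_true n) ?_
  rw [length_halfEdgesB, Nat.mod_eq_of_lt (by omega), ← halfEdgesB_getElem?_odd n (n - 1) (by omega)]
  congr 1; omega

theorem formPerm_halfEdgesB_odd (i : ℕ) (hi : i < n) :
    (halfEdgesB n).formPerm (⟨2 * i + 1, by omega⟩, true) = (⟨2 * i + 2, by omega⟩, true) := by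
  refine List.formPerm_apply_of_getElem? (nodup_halfEdgesB n) (halfEdgesB_getElem?_odd n i hi) ?_
  rw [length_halfEdgesB, Nat.mod_eq_of_lt (by omega), ← halfEdgesB_getElem?_even n i hi]

theorem formPerm_halfEdgesB_even (i : ℕ) (hi : i + 1 < n) :
    (halfEdgesB n).formPerm (⟨2 * (i + 1) + 2, by omega⟩, true) =
      (⟨2 * i + 1, by omega⟩, true) := by
  refine List.formPerm_apply_of_getElem? (nodup_halfEdgesB n) (halfEdgesB_getElem?_even n _ hi) ?_
  rw [length_halfEdgesB, Nat.mod_eq_of_lt (by omega), ← halfEdgesB_getElem?_odd n i (by omega)]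
  congr 1; omega

theorem formPerm_halfEdgesB_two (hn : 1 ≤ n) :
    (halfEdgesB n).formPerm (⟨2 * 0 + 2, by omega⟩, true) = (0, false) := by
  refine List.formPerm_apply_of_getElem? (nodup_halfEdgesB n) (halfEdgesB_getElem?_even n 0 hn) ?_
  rw [length_halfEdgesB, show (4 * n - 2 * 0 + 1 + 1) % (4 * n + 2) = 0 by simp]
  exact halfEdgesB_getElem?_false n 0 (by omega)

end Successor

/-! ### Corner arcs of the bouquet -/

namespace SignedRotation

variable {E : Type*} [Fintype E] [DecidableEq E] (R : SignedRotation E)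

theorem bouquet_corner_exit (h : E × Bool) :
    R.bouquet.corner (h.1, h.2, !R.entry h) =
      ((R.halfEdges.formPerm h).1, (R.halfEdges.formPerm h).2,
        R.entry (R.halfEdges.formPerm h)) := by
  simp [bouquet]

/-- Every corner arc joins the exit of a half-edge to the entry of the next one. -/
theorem bouquet_apply_corner_eq {β : Type*} (f : E × Bool × Bool → β)
    (hf : ∀ h : E × Bool, f (h.1, h.2, !R.entry h) = f ((R.halfEdges.formPerm h).1,
      (R.halfEdges.formPerm h).2, R.entry (R.halfEdges.formPerm h)))
    (x : E × Bool × Bool) : f (R.bouquet.corner x) = f x := by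
  obtain ⟨e, i, s⟩ := x
  by_cases hs : s = R.entry (e, i)
  · subst hs
    simpa [bouquet] using hf (R.halfEdges.formPerm⁻¹ (e, i))
  · have h2 : s = !R.entry (e, i) := by
      cases s <;> cases h3 : R.entry (e, i) <;> simp_all
    subst h2
    rw [bouquet_corner_exit R (e, i)]
    exact (hf (e, i)).symm

end SignedRotation

/-- The flags of `B_{2n+1}`, indexed by natural numbers (loops are taken modulo `2 * n + 1`). -/
def flagB (n v : ℕ) (i s : Bool) : Fin (2 * n + 1) × Bool × Bool := (Fin.ofNat (2 * n + 1) v, i, s)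

theorem ofNat_eq_mk {n v : ℕ} (hv : v < 2 * n + 1) : Fin.ofNat (2 * n + 1) v = ⟨v, hv⟩ :=
  Fin.ext (Nat.mod_eq_of_lt hv)

theorem flagB_eq_mk {n v : ℕ} (hv : v < 2 * n + 1) (i s : Bool) :
    flagB n v i s = (⟨v, hv⟩, i, s) := by
  rw [flagB, ofNat_eq_mk hv]

theorem flagB_val {n : ℕ} (x : Fin (2 * n + 1) × Bool × Bool) :
    flagB n x.1.val x.2.1 x.2.2 = x := by
  rw [flagB_eq_mk x.1.isLt]

theorem rotationB_entry_false (n : ℕ) (e : Fin (2 * n + 1)) :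
    (rotationB n).entry (e, false) = false := by
  simp [SignedRotation.entry, rotationB]

theorem rotationB_entry_zero_true (n : ℕ) : (rotationB n).entry (0, true) = false := by
  simp [SignedRotation.entry, rotationB]

theorem rotationB_entry_true (n : ℕ) {v : ℕ} (hv : v < 2 * n + 1) (h0 : 0 < v) :
    (rotationB n).entry (⟨v, hv⟩, true) = true := by
  simp [SignedRotation.entry, rotationB, Fin.ext_iff]
  omega

theorem bouquetB_corner_of_formPerm {n : ℕ} {h k : Fin (2 * n + 1) × Bool}
    (hk : (halfEdgesB n).formPerm h = k) :
    (bouquetB n).corner (h.1, h.2, !(rotationB n).entry h) = (k.1, k.2, (rotationB n).entry k) := by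
  subst hk
  exact (rotationB n).bouquet_corner_exit h

section CornerArcs

variable {n : ℕ}

theorem bouquetB_corner_false {j : ℕ} (hj : j < 2 * n) :
    (bouquetB n).corner (flagB n j false true) = flagB n (j + 1) false false := by
  have := bouquetB_corner_of_formPerm (formPerm_halfEdgesB_false n j hj)
  simp only [rotationB_entry_false] at this
  rw [flagB_eq_mk (by omega), flagB_eq_mk (by omega)]
  exact this

theorem bouquetB_corner_last_false :
    (bouquetB n).corner (flagB n (2 * n) false true) = flagB n 0 true false := by
  have := bouquetB_corner_of_formPerm (formPerm_halfEdgesB_last_false n)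
  simp only [rotationB_entry_false, rotationB_entry_zero_true] at this
  rw [flagB_eq_mk (by omega), flagB_eq_mk (by omega)]
  exact this

theorem bouquetB_corner_zero_true (hn : 1 ≤ n) :
    (bouquetB n).corner (flagB n 0 true true) = flagB n (2 * (n - 1) + 1) true true := by
  have := bouquetB_corner_of_formPerm (formPerm_halfEdgesB_zero_true n hn)
  rw [rotationB_entry_zero_true, rotationB_entry_true n _ (by omega)] at this
  rw [flagB_eq_mk (by omega), flagB_eq_mk (by omega)]
  exact this

theorem bouquetB_corner_odd {i : ℕ} (hi : i < n) :
    (bouquetB n).corner (flagB n (2 * i + 1) true false) = flagB n (2 * i + 2) true true := by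
  have := bouquetB_corner_of_formPerm (formPerm_halfEdgesB_odd n i hi)
  rw [rotationB_entry_true n _ (by omega), rotationB_entry_true n _ (by omega)] at this
  rw [flagB_eq_mk (by omega), flagB_eq_mk (by omega)]
  exact this

theorem bouquetB_corner_even {i : ℕ} (hi : i + 1 < n) :
    (bouquetB n).corner (flagB n (2 * (i + 1) + 2) true false) = flagB n (2 * i + 1) true true := by
  have := bouquetB_corner_of_formPerm (formPerm_halfEdgesB_even n i hi)
  rw [rotationB_entry_true n _ (by omega), rotationB_entry_true n _ (by omega)] at this
  rw [flagB_eq_mk (by omega), flagB_eq_mk (by omega)]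
  exact this

theorem bouquetB_corner_two (hn : 1 ≤ n) :
    (bouquetB n).corner (flagB n (2 * 0 + 2) true false) = flagB n 0 false false := by
  have := bouquetB_corner_of_formPerm (formPerm_halfEdgesB_two n hn)
  rw [rotationB_entry_true n _ (by omega), rotationB_entry_false] at this
  rw [flagB_eq_mk (by omega), flagB_eq_mk (by omega)]
  exact this

theorem loop_cases {n v : ℕ} (hv : v < 2 * n + 1) :
    v = 0 ∨ ∃ i < n, v = 2 * i + 1 ∨ v = 2 * i + 2 := by
  rcases Nat.eq_zero_or_pos v with h | h
  · exact Or.inl h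
  · exact Or.inr ⟨(v - 1) / 2, by omega, by omega⟩

/-- A function on the flags that agrees at the two ends of each of the listed corner arcs is constant
along all corner arcs. -/
theorem bouquetB_apply_corner_eq (hn : 1 ≤ n) {β : Type*} (f : Fin (2 * n + 1) × Bool × Bool → β)
    (hfalse : ∀ j < 2 * n, f (flagB n j false true) = f (flagB n (j + 1) false false))
    (hlast : f (flagB n (2 * n) false true) = f (flagB n 0 true false))
    (hzero : f (flagB n 0 true true) = f (flagB n (2 * (n - 1) + 1) true true))
    (hodd : ∀ i < n, f (flagB n (2 * i + 1) true false) = f (flagB n (2 * i + 2) true true))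
    (heven : ∀ i, i + 1 < n →
      f (flagB n (2 * (i + 1) + 2) true false) = f (flagB n (2 * i + 1) true true))
    (htwo : f (flagB n (2 * 0 + 2) true false) = f (flagB n 0 false false))
    (x : Fin (2 * n + 1) × Bool × Bool) : f ((bouquetB n).corner x) = f x := by
  refine (rotationB n).bouquet_apply_corner_eq f ?_ x
  intro h
  have key : f ((bouquetB n).corner (h.1, h.2, !(rotationB n).entry h)) =
      f (h.1, h.2, !(rotationB n).entry h) := by
    obtain ⟨⟨v, hv⟩, b⟩ := h
    cases b
    · rw [rotationB_entry_false, ← flagB_eq_mk hv]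
      rcases Nat.lt_or_ge v (2 * n) with h | h
      · rw [Bool.not_false, bouquetB_corner_false h, hfalse v h]
      · obtain rfl : v = 2 * n := by omega
        rw [Bool.not_false, bouquetB_corner_last_false, hlast]
    · rcases loop_cases hv with rfl | ⟨i, hi, rfl | rfl⟩
      · have := bouquetB_corner_zero_true hn
        rw [flagB_eq_mk (by omega)] at this hzero
        erw [rotationB_entry_zero_true]
        rw [Bool.not_false, this, hzero]
      · rw [rotationB_entry_true n hv (by omega), ← flagB_eq_mk hv, Bool.not_true,
          bouquetB_corner_odd hi, hodd i hi]
      · rw [rotationB_entry_true n hv (by omega), ← flagB_eq_mk hv, Bool.not_true]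
        cases i with
        | zero => rw [bouquetB_corner_two hn, htwo]
        | succ i => rw [bouquetB_corner_even hi, heven i hi]
  rw [← key]
  exact congrArg f ((rotationB n).bouquet_corner_exit h)

end CornerArcs

/-! ### Non-orientability -/

/-- The loop `0` is twisted, and the entries of all half-edges have the same colour. -/
theorem not_orientable_bouquetB (n : ℕ) : ¬ (bouquetB n).Orientable := by
  rintro ⟨c, hc⟩
  have across_flag (v : ℕ) : c (flagB n v false true) = !c (flagB n v false false) :=
    (hc (flagB n v false false)).1
  -- From one entry to the next, the attaching arc and the corner arc each flip the colour once.
  have h : ∀ j ≤ 2 * n, c (flagB n j false false) = c (flagB n 0 false false) := by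
    intro j
    induction j with
    | zero => intro _; rfl
    | succ j ih =>
      intro hj
      have h1 := (hc (flagB n j false true)).2.2
      rw [bouquetB_corner_false (by omega), across_flag, ih (by omega), Bool.not_not] at h1
      exact h1
  have h1 := (hc (flagB n (2 * n) false true)).2.2
  rw [bouquetB_corner_last_false, across_flag, h _ le_rfl, Bool.not_not] at h1
  have h2 : c (flagB n 0 true false) = !c (flagB n 0 false false) := (hc (flagB n 0 false false)).2.1
  rw [h1] at h2
  simp at h2

/-! ### Curves formed by two channels -/

theorem Nat.exists_count_eq {p : ℕ → Prop} [DecidablePred p] {n k : ℕ} (hk : k ≤ Nat.count p n) :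
    ∃ i ≤ n, Nat.count p i = k := by
  induction n with
  | zero => exact ⟨0, le_rfl, by simp at hk; simp [hk]⟩
  | succ n ih =>
    rcases Nat.lt_or_ge (Nat.count p n) k with h | h
    · refine ⟨n + 1, le_rfl, ?_⟩
      rw [Nat.count_succ] at hk ⊢
      split_ifs at hk ⊢ <;> omega
    · obtain ⟨i, hi, rfl⟩ := ih h
      exact ⟨i, by omega, rfl⟩

/-- Two channels `L 0, …, L n` and `R 0, …, R n`; step `i` joins `L i` to `R i` and `L (i + 1)` to
`R (i + 1)` if `p i` holds, and continues both channels otherwise. At the outer ends the channels are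
closed up, either untwisted (`c = false`) or twisted (`c = true`). -/
structure Channels {Q : Type*} (n : ℕ) (p : ℕ → Prop) (c : Bool) (L R : ℕ → Q) : Prop where
  left : ∀ i < n, ¬ p i → L i = L (i + 1)
  right : ∀ i < n, ¬ p i → R i = R (i + 1)
  lower : ∀ i < n, p i → L i = R i
  upper : ∀ i < n, p i → L (i + 1) = R (i + 1)
  bottom : c = false → L 0 = R 0
  twist : c = true → R 0 = L n

/-- The number of curves formed by a pair of channels with `t` turns. -/
def numCurves (c : Bool) (t : ℕ) : ℕ := if c then max t 1 else t + 1

namespace Channels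

variable {Q : Type*} {n : ℕ} {p : ℕ → Prop} [DecidablePred p] {c : Bool} {L R : ℕ → Q}

/-- Equal counts mean that no turn lies between `i` and `j`, so both channels run straight. -/
theorem eq_of_count_eq (h : Channels n p c L R) {i j : ℕ} (hi : i ≤ n) (hj : j ≤ n)
    (hij : Nat.count p i = Nat.count p j) : L i = L j ∧ R i = R j := by
  have aux : ∀ i j, i ≤ j → j ≤ n → Nat.count p i = Nat.count p j → L i = L j ∧ R i = R j := by
    intro i j hij
    induction j, hij using Nat.le_induction with
    | base => simp
    | succ j hij ih =>
      intro hj hc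
      have h1 : Nat.count p i ≤ Nat.count p j := Nat.count_monotone p hij
      rw [Nat.count_succ] at hc
      have hp : ¬ p j := by
        intro hp
        rw [if_pos hp] at hc
        omega
      rw [if_neg hp] at hc
      obtain ⟨h2, h3⟩ := ih (by omega) hc
      exact ⟨h2.trans (h.left j (by omega) hp), h3.trans (h.right j (by omega) hp)⟩
  rcases Nat.le_total i j with hle | hle
  · exact aux i j hle hj hij
  · obtain ⟨h1, h2⟩ := aux j i hle hi hij.symm
    exact ⟨h1.symm, h2.symm⟩

/-- The last turn below `i` joins the channels just above it, and they run straight from there to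
`i`. -/
theorem left_eq_right_of_count_pos (h : Channels n p c L R) {i : ℕ} (hi : i ≤ n)
    (hpos : 0 < Nat.count p i) : L i = R i := by
  induction i with
  | zero => simp at hpos
  | succ i ih =>
    by_cases hp : p i
    · exact h.upper i (by omega) hp
    · rw [Nat.count_succ, if_neg hp] at hpos
      rw [← h.left i (by omega) hp, ← h.right i (by omega) hp]
      exact ih (by omega) hpos

/-- The mirror argument, with the first turn at or above `i`. -/
theorem left_eq_right_of_count_lt (h : Channels n p c L R) {i : ℕ} (hi : i ≤ n)
    (hlt : Nat.count p i < Nat.count p n) : L i = R i := by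
  induction hi using Nat.decreasingInduction with
  | self => omega
  | of_succ i hi ih =>
    by_cases hp : p i
    · exact h.lower i hi hp
    · rw [h.left i hi hp, h.right i hi hp]
      exact ih (by rwa [Nat.count_succ, if_neg hp])

/-- Without any turn the closure at the ends must join the channels. In the twisted case this is `R
0 = L n = L 0`, which an untwisted ribbon would not give. -/
theorem left_eq_right (h : Channels n p c L R) {i : ℕ} (hi : i ≤ n) : L i = R i := by
  rcases Nat.eq_zero_or_pos (Nat.count p i) with h0 | h0
  · rcases Nat.eq_zero_or_pos (Nat.count p n) with h1 | h1
    · obtain ⟨h2, h3⟩ := h.eq_of_count_eq hi (Nat.zero_le n) (by simp [h0])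
      rw [h2, h3]
      cases c with
      | false => exact h.bottom rfl
      | true =>
        rw [h.twist rfl]
        exact (h.eq_of_count_eq (Nat.zero_le n) le_rfl (by simp [h1])).1
    · exact h.left_eq_right_of_count_lt hi (by omega)
  · exact h.left_eq_right_of_count_pos hi h0

/-- Each level is one curve, and the modulus identifies two different levels only when the twisted
closure does: levels `0` and `t`. -/
theorem eq_of_count_mod_eq (h : Channels n p c L R) {i j : ℕ} (hi : i ≤ n) (hj : j ≤ n)
    (hij : Nat.count p i % numCurves c (Nat.count p n) =
      Nat.count p j % numCurves c (Nat.count p n)) : L i = L j := by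
  have hi' : Nat.count p i ≤ Nat.count p n := Nat.count_monotone p hi
  have hj' : Nat.count p j ≤ Nat.count p n := Nat.count_monotone p hj
  by_cases heq : Nat.count p i = Nat.count p j
  · exact (h.eq_of_count_eq hi hj heq).1
  cases c with
  | false =>
    simp only [numCurves, Bool.false_eq_true, if_false] at hij
    rw [Nat.mod_eq_of_lt (by omega), Nat.mod_eq_of_lt (by omega)] at hij
    exact absurd hij heq
  | true =>
    have ends : L 0 = L n := (h.left_eq_right (Nat.zero_le n)).trans (h.twist rfl)
    have join : ∀ a b, a ≤ n → b ≤ n → Nat.count p a = 0 → Nat.count p b = Nat.count p n →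
        L a = L b := by
      intro a b ha hb h0 h1
      rw [(h.eq_of_count_eq ha (Nat.zero_le n) (by simp [h0])).1,
        (h.eq_of_count_eq hb le_rfl h1).1, ends]
    -- The two counts differ and are at most `t`, so `t > 0` and `max t 1 = t`.
    have hN : numCurves true (Nat.count p n) = Nat.count p n := by
      simp [numCurves]
      omega
    rw [hN] at hij
    rcases Nat.lt_or_ge (Nat.count p i) (Nat.count p n) with h1 | h1
    · rcases Nat.lt_or_ge (Nat.count p j) (Nat.count p n) with h2 | h2
      · rw [Nat.mod_eq_of_lt h1, Nat.mod_eq_of_lt h2] at hij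
        exact absurd hij heq
      · have h3 := le_antisymm hj' h2
        rw [Nat.mod_eq_of_lt h1, h3, Nat.mod_self] at hij
        exact join i j hi hj hij h3
    · have h3 := le_antisymm hi' h1
      rw [Nat.mod_eq_of_lt (a := Nat.count p j) (by omega), h3, Nat.mod_self] at hij
      exact (join j i hj hi hij.symm h3).symm

end Channels

/-! ### The level as an invariant of curves -/

open RibbonGraph

/-- Leave a flag along the free side on the loops with `m v = true`, along the attaching arc on the
others. -/
def sideStep (n : ℕ) (m : ℕ → Bool) (x : Fin (2 * n + 1) × Bool × Bool) :
    Fin (2 * n + 1) × Bool × Bool :=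
  if m x.1.val then along x else across x

/-- Exactly one loop of the pair `2 * i + 1`, `2 * i + 2` is selected. -/
def SplitPair (m : ℕ → Bool) (i : ℕ) : Prop := m (2 * i + 1) ≠ m (2 * i + 2)

instance (m : ℕ → Bool) : DecidablePred (SplitPair m) := fun i =>
  inferInstanceAs (Decidable (m (2 * i + 1) ≠ m (2 * i + 2)))

/-- The number of split pairs below a flag. -/
def levelB (n : ℕ) (m : ℕ → Bool) (v : ℕ) (i s : Bool) : ℕ :=
  if v = 0 then Nat.count (SplitPair m) (if i then n else 0)
  else
    let k := (v - 1) / 2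
    let upper : Bool :=
      if v % 2 = 1 then (if i = s then i else xor i (m v))
      else (if i = s then xor i (m (v - 1)) else s)
    Nat.count (SplitPair m) (if upper then k + 1 else k)

section Level

variable (n : ℕ) (m : ℕ → Bool)

theorem levelB_zero (i s : Bool) :
    levelB n m 0 i s = Nat.count (SplitPair m) (if i then n else 0) := by
  simp [levelB]

theorem levelB_odd (k : ℕ) (i s : Bool) :
    levelB n m (2 * k + 1) i s = Nat.count (SplitPair m)
      (if (if i = s then i else xor i (m (2 * k + 1))) then k + 1 else k) := by
  have h1 : (2 * k + 1) % 2 = 1 := by omega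
  have h2 : (2 * k + 1 - 1) / 2 = k := by omega
  simp only [levelB, h1, h2]
  simp

theorem levelB_even (k : ℕ) (i s : Bool) :
    levelB n m (2 * k + 2) i s = Nat.count (SplitPair m)
      (if (if i = s then xor i (m (2 * k + 1)) else s) then k + 1 else k) := by
  have h1 : (2 * k + 2) % 2 ≠ 1 := by omega
  have h2 : (2 * k + 2 - 1) / 2 = k := by omega
  have h3 : 2 * k + 2 - 1 = 2 * k + 1 := by omega
  simp only [levelB, h1, h2]
  simp [h3]

theorem levelB_left (i : ℕ) : levelB n m (2 * i) false true = Nat.count (SplitPair m) i := by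
  cases i with
  | zero => simp [levelB_zero]
  | succ i => rw [Nat.mul_add, levelB_even]; simp

theorem levelB_corner (hn : 1 ≤ n) (x : Fin (2 * n + 1) × Bool × Bool) :
    levelB n m ((bouquetB n).corner x).1.val ((bouquetB n).corner x).2.1
      ((bouquetB n).corner x).2.2 = levelB n m x.1.val x.2.1 x.2.2 := by
  have val {v : ℕ} (hv : v < 2 * n + 1) (i s : Bool) :
      levelB n m (flagB n v i s).1.val (flagB n v i s).2.1 (flagB n v i s).2.2 =
        levelB n m v i s := by rw [flagB_eq_mk hv]
  refine bouquetB_apply_corner_eq hn (fun x => levelB n m x.1.val x.2.1 x.2.2)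
    ?_ ?_ ?_ ?_ ?_ ?_ x
  · intro j hj
    rw [val (by omega), val (by omega)]
    rcases Nat.even_or_odd' j with ⟨k, rfl | rfl⟩
    · rw [levelB_left, levelB_odd]; simp
    · rw [levelB_odd, levelB_even]; simp
  · rw [val (by omega), val (by omega), levelB_left, levelB_zero]; simp
  · rw [val (by omega), val (by omega), levelB_zero, levelB_odd]; simp [Nat.sub_add_cancel hn]
  · intro i hi
    rw [val (by omega), val (by omega), levelB_odd, levelB_even]; simp
  · intro i hi
    rw [val (by omega), val (by omega), levelB_odd, levelB_even]; simp
  · rw [val (by omega), val (by omega), levelB_zero, levelB_even]; simp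

/-- The modulus is needed only at loop `0`: when selected it joins level `0` to level `t`, which
agree modulo `max t 1`. On an even loop the side may cross from one level to the next only if the
pair is not split, and then the counts coincide. -/
theorem levelB_sideStep (x : Fin (2 * n + 1) × Bool × Bool) :
    levelB n m (sideStep n m x).1.val (sideStep n m x).2.1 (sideStep n m x).2.2 %
        numCurves (m 0) (Nat.count (SplitPair m) n) =
      levelB n m x.1.val x.2.1 x.2.2 % numCurves (m 0) (Nat.count (SplitPair m) n) := by
  obtain ⟨⟨v, hv⟩, i, s⟩ := x
  rcases loop_cases hv with rfl | ⟨k, hk, rfl | rfl⟩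
  · simp only [sideStep]
    cases h : m 0
    · simp [across, levelB_zero]
    · rcases Nat.eq_zero_or_pos (Nat.count (SplitPair m) n) with h0 | h0
      · cases i <;> simp [along, levelB_zero, numCurves, h0]
      · have : max (Nat.count (SplitPair m) n) 1 = Nat.count (SplitPair m) n := by omega
        cases i <;> simp [along, levelB_zero, numCurves, this]
  · congr 1
    simp only [sideStep]
    cases h : m (2 * k + 1) <;> cases i <;> cases s <;> simp [along, across, levelB_odd, h]
  · congr 1
    have hc : Nat.count (SplitPair m) (k + 1) =
        Nat.count (SplitPair m) k + if m (2 * k + 1) ≠ m (2 * k + 2) then 1 else 0 := by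
      rw [Nat.count_succ]; rfl
    simp only [sideStep]
    cases h : m (2 * k + 1) <;> cases h' : m (2 * k + 2) <;> cases i <;> cases s <;>
      simp [along, across, levelB_even, h, h', hc]

end Level

/-! ### The two channels of the bouquet -/

section Curves

variable {n : ℕ} {m : ℕ → Bool} {Q : Type*} {q : Fin (2 * n + 1) × Bool × Bool → Q}

/-- The right channel of `B_{2n+1}`, the left one being `fun i => q (flagB n (2 * i) false true)`. -/
def rightChannel (q : Fin (2 * n + 1) × Bool × Bool → Q) (i : ℕ) : Q :=
  if i = 0 then q (flagB n 0 false false) else q (flagB n (2 * (i - 1) + 1) true true)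

theorem sideStep_flagB {v : ℕ} (hv : v < 2 * n + 1) (i s : Bool) :
    sideStep n m (flagB n v i s) = if m v then flagB n v (!i) s else flagB n v i (!s) := by
  simp only [flagB_eq_mk hv, sideStep, along, across]

theorem apply_flagB_end (hs : ∀ x, q (sideStep n m x) = q x) {v : ℕ} (hv : v < 2 * n + 1)
    (h : m v = true) (s : Bool) : q (flagB n v true s) = q (flagB n v false s) := by
  simpa [sideStep_flagB hv, h] using hs (flagB n v false s)

theorem apply_flagB_side (hs : ∀ x, q (sideStep n m x) = q x) {v : ℕ} (hv : v < 2 * n + 1)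
    (h : m v = false) (i : Bool) : q (flagB n v i true) = q (flagB n v i false) := by
  simpa [sideStep_flagB hv, h] using hs (flagB n v i false)

theorem apply_left_lower (hc : ∀ x, q ((bouquetB n).corner x) = q x)
    (i : ℕ) (hi : i < n) :
    q (flagB n (2 * i + 1) false false) = q (flagB n (2 * i) false true) := by
  rw [← hc (flagB n (2 * i) false true), bouquetB_corner_false (by omega)]

theorem apply_left_middle (hc : ∀ x, q ((bouquetB n).corner x) = q x)
    (i : ℕ) (hi : i < n) :
    q (flagB n (2 * i + 2) false false) = q (flagB n (2 * i + 1) false true) := by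
  rw [← hc (flagB n (2 * i + 1) false true), bouquetB_corner_false (by omega)]

theorem apply_right_middle (hc : ∀ x, q ((bouquetB n).corner x) = q x)
    (i : ℕ) (hi : i < n) :
    q (flagB n (2 * i + 2) true true) = q (flagB n (2 * i + 1) true false) := by
  rw [← hc (flagB n (2 * i + 1) true false), bouquetB_corner_odd hi]

theorem apply_right_lower (hn : 1 ≤ n) (hc : ∀ x, q ((bouquetB n).corner x) = q x)
    (i : ℕ) (hi : i < n) :
    q (flagB n (2 * i + 2) true false) = rightChannel q i := by
  cases i with
  | zero => rw [← hc, bouquetB_corner_two hn]; simp [rightChannel]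
  | succ i => rw [← hc, bouquetB_corner_even hi]; simp [rightChannel]

theorem apply_zero_true_true (hn : 1 ≤ n) (hc : ∀ x, q ((bouquetB n).corner x) = q x) :
    q (flagB n 0 true true) = rightChannel q n := by
  rw [← hc, bouquetB_corner_zero_true hn, rightChannel, if_neg (by omega)]

theorem apply_zero_true_false (hc : ∀ x, q ((bouquetB n).corner x) = q x) :
    q (flagB n 0 true false) = q (flagB n (2 * n) false true) := by
  rw [← hc (flagB n (2 * n) false true), bouquetB_corner_last_false]

/-- The four ways to run through a pair of loops. -/
theorem pair_cases (hn : 1 ≤ n) (hc : ∀ x, q ((bouquetB n).corner x) = q x)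
    (hs : ∀ x, q (sideStep n m x) = q x) (i : ℕ) (hi : i < n) :
    let L := fun i => q (flagB n (2 * i) false true)
    let R := rightChannel q
    let a := q (flagB n (2 * i + 1) false true)
    let b := q (flagB n (2 * i + 1) true false)
    (SplitPair m i → L i = R i ∧ L (i + 1) = R (i + 1)) ∧
      (¬ SplitPair m i → L i = L (i + 1) ∧ R i = R (i + 1)) ∧
      (a = L i ∨ a = L (i + 1) ∨ a = R (i + 1)) ∧ (b = L i ∨ b = R i ∨ b = R (i + 1)) := by
  intro L R a b
  have e1 : q (flagB n (2 * i + 1) false false) = L i := apply_left_lower hc i hi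
  have e2 : q (flagB n (2 * i + 2) false false) = a := apply_left_middle hc i hi
  have e3 : q (flagB n (2 * i + 2) true true) = b := apply_right_middle hc i hi
  have e4 : q (flagB n (2 * i + 2) true false) = R i := apply_right_lower hn hc i hi
  have e5 : q (flagB n (2 * i + 2) false true) = L (i + 1) := by simp only [L]; congr 1
  have e6 : q (flagB n (2 * i + 1) true true) = R (i + 1) := by simp [R, rightChannel]
  have h1 : 2 * i + 1 < 2 * n + 1 := by omega
  have h2 : 2 * i + 2 < 2 * n + 1 := by omega
  cases ha : m (2 * i + 1) <;> cases hb : m (2 * i + 2) <;>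
    simp only [SplitPair, ha, hb]
  · have f1 := apply_flagB_side hs h1 ha false
    have f2 := apply_flagB_side hs h1 ha true
    have f3 := apply_flagB_side hs h2 hb false
    have f4 := apply_flagB_side hs h2 hb true
    grind
  · have f1 := apply_flagB_side hs h1 ha false
    have f2 := apply_flagB_side hs h1 ha true
    have f3 := apply_flagB_end hs h2 hb false
    have f4 := apply_flagB_end hs h2 hb true
    grind
  · have f1 := apply_flagB_end hs h1 ha false
    have f2 := apply_flagB_end hs h1 ha true
    have f3 := apply_flagB_side hs h2 hb false
    have f4 := apply_flagB_side hs h2 hb true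
    grind
  · have f1 := apply_flagB_end hs h1 ha false
    have f2 := apply_flagB_end hs h1 ha true
    have f3 := apply_flagB_end hs h2 hb false
    have f4 := apply_flagB_end hs h2 hb true
    grind

theorem channels_bouquetB (hn : 1 ≤ n) (hc : ∀ x, q ((bouquetB n).corner x) = q x)
    (hs : ∀ x, q (sideStep n m x) = q x) :
    Channels n (SplitPair m) (m 0) (fun i => q (flagB n (2 * i) false true)) (rightChannel q) where
  left i hi hp := ((pair_cases hn hc hs i hi).2.1 hp).1
  right i hi hp := ((pair_cases hn hc hs i hi).2.1 hp).2
  lower i hi hp := ((pair_cases hn hc hs i hi).1 hp).1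
  upper i hi hp := ((pair_cases hn hc hs i hi).1 hp).2
  bottom h := by simpa [rightChannel] using apply_flagB_side hs (by omega) h false
  -- Both ends of the twisted loop `0` are entered on the side `false`, so this free side joins the
  -- bottom of the right channel to the top of the left one.
  twist h := by
    rw [← apply_zero_true_false hc, apply_flagB_end hs (by omega) h]
    simp [rightChannel]

/-- Every curve meets the left channel, so the levels of its points determine all curves. -/
theorem exists_apply_eq_left (hn : 1 ≤ n) (hc : ∀ x, q ((bouquetB n).corner x) = q x)
    (hs : ∀ x, q (sideStep n m x) = q x) (x : Fin (2 * n + 1) × Bool × Bool) :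
    ∃ i ≤ n, q x = q (flagB n (2 * i) false true) := by
  have ch := channels_bouquetB hn hc hs
  have hR : ∀ i ≤ n, rightChannel q i = q (flagB n (2 * i) false true) :=
    fun i hi => (ch.left_eq_right hi).symm
  suffices h : ∃ i ≤ n, q x = q (flagB n (2 * i) false true) ∨ q x = rightChannel q i by
    obtain ⟨i, hi, h | h⟩ := h
    · exact ⟨i, hi, h⟩
    · exact ⟨i, hi, h.trans (hR i hi)⟩
  rw [← flagB_val x]
  obtain ⟨⟨v, hv⟩, i, s⟩ := x
  simp only
  rcases loop_cases hv with rfl | ⟨k, hk, rfl | rfl⟩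
  · cases i <;> cases s
    · exact ⟨0, by omega, Or.inr (by simp [rightChannel])⟩
    · exact ⟨0, by omega, Or.inl rfl⟩
    · exact ⟨n, le_rfl, Or.inl (apply_zero_true_false hc)⟩
    · exact ⟨n, le_rfl, Or.inr (apply_zero_true_true hn hc)⟩
  all_goals
    obtain ⟨-, -, ha, hb⟩ := pair_cases hn hc hs k hk
    have hk' : k + 1 ≤ n := hk
    have hk'' : k ≤ n := by omega
    cases i <;> cases s
  · exact ⟨k, hk'', Or.inl (apply_left_lower hc k hk)⟩
  · grind
  · grind
  · exact ⟨k + 1, hk', Or.inr (by simp [rightChannel])⟩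
  · rw [apply_left_middle hc k hk]; grind
  · exact ⟨k + 1, hk', Or.inl rfl⟩
  · exact ⟨k, hk'', Or.inr (apply_right_lower hn hc k hk)⟩
  · rw [apply_right_middle hc k hk]; grind

end Curves

/-- The number of boundary components of the spanning ribbon subgraph of `B_{2n+1}` whose loops are
those selected by `m`. -/
theorem card_quot_sideStep (n : ℕ) (hn : 1 ≤ n) (m : ℕ → Bool) :
    Nat.card (Quot fun x y => y = sideStep n m x ∨ y = (bouquetB n).corner x) =
      numCurves (m 0) (Nat.count (SplitPair m) n) := by
  set r := fun x y => y = sideStep n m x ∨ y = (bouquetB n).corner x with hr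
  set N := numCurves (m 0) (Nat.count (SplitPair m) n) with hN
  have hpos : 0 < N := by
    rw [hN, numCurves]
    split_ifs <;> omega
  have hle : N ≤ Nat.count (SplitPair m) n + 1 := by
    rw [hN, numCurves]
    split_ifs <;> omega
  let g : Quot r → Fin N := Quot.lift
    (fun x => ⟨levelB n m x.1.val x.2.1 x.2.2 % N, Nat.mod_lt _ hpos⟩) (by
      rintro x y (rfl | rfl)
      · exact Fin.ext (levelB_sideStep n m x).symm
      · exact Fin.ext (congrArg (· % N) (levelB_corner n m hn x).symm))
  have hleft : ∀ i ≤ n, (g (Quot.mk r (flagB n (2 * i) false true))).val =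
      Nat.count (SplitPair m) i % N := by
    intro i hi
    rw [← levelB_left n m i, flagB_eq_mk (by omega)]
  have hc : ∀ x, Quot.mk r ((bouquetB n).corner x) = Quot.mk r x :=
    fun x => (Quot.sound (r := r) (Or.inr rfl)).symm
  have hs : ∀ x, Quot.mk r (sideStep n m x) = Quot.mk r x :=
    fun x => (Quot.sound (r := r) (Or.inl rfl)).symm
  -- Injectivity: the channel relations merge all points of equal level. Surjectivity: the count
  -- grows by at most one per pair, so it takes every value up to `t`.
  have hg : Function.Bijective g := by
    constructor
    · rintro ⟨x⟩ ⟨y⟩ hxy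
      obtain ⟨i, hi, hx⟩ := exists_apply_eq_left hn hc hs x
      obtain ⟨j, hj, hy⟩ := exists_apply_eq_left hn hc hs y
      rw [hx, hy] at hxy ⊢
      have := congrArg Fin.val hxy
      rw [hleft i hi, hleft j hj] at this
      exact (channels_bouquetB hn hc hs).eq_of_count_mod_eq hi hj this
    · rintro ⟨k, hk⟩
      obtain ⟨i, hi, rfl⟩ := Nat.exists_count_eq (p := SplitPair m) (n := n) (k := k) (by omega)
      exact ⟨Quot.mk r (flagB n (2 * i) false true), Fin.ext ((hleft i hi).trans (Nat.mod_eq_of_lt hk))⟩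
  rw [Nat.card_eq_of_bijective g hg, Nat.card_fin]

/-! ### Partial duality as an exchange of flags -/

namespace RibbonGraph

variable {E : Type*} [DecidableEq E]

/-- `exchange A` as a permutation of the flags. -/
def exchangeEquiv (A : Finset E) : E × Bool × Bool ≃ E × Bool × Bool where
  toFun := exchange A
  invFun := exchange A
  left_inv := exchange_exchange A
  right_inv := exchange_exchange A

theorem exchange_across (A : Finset E) (x : E × Bool × Bool) :
    exchange A (across x) = if x.1 ∈ A then along (exchange A x) else across (exchange A x) := by
  by_cases h : x.1 ∈ A <;> simp [exchange, across, along, h]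

theorem exchange_along (A : Finset E) (x : E × Bool × Bool) :
    exchange A (along x) = if x.1 ∈ A then across (exchange A x) else along (exchange A x) := by
  by_cases h : x.1 ∈ A <;> simp [exchange, across, along, h]

theorem exchange_fst (A : Finset E) (x : E × Bool × Bool) : (exchange A x).1 = x.1 := by
  by_cases h : x.1 ∈ A <;> simp [exchange, h]

theorem eq_partialDual_corner_iff (G : RibbonGraph E) (A : Finset E) (x y : E × Bool × Bool) :
    y = (G.partialDual A).corner x ↔ exchange A y = G.corner (exchange A x) := by
  rw [← (exchangeEquiv A).apply_eq_iff_eq]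
  simp [exchangeEquiv, partialDual, exchange_exchange]

/-- Conjugating by `exchange A` restores the corner arcs of `G` and turns attaching arcs into free
sides on `A`. -/
theorem card_quot_across_partialDual (G : RibbonGraph E) (A : Finset E) :
    Nat.card (Quot fun x y => y = across x ∨ y = (G.partialDual A).corner x) =
      Nat.card (Quot fun x y =>
        (y = if x.1 ∈ A then along x else across x) ∨ y = G.corner x) := by
  refine Nat.card_congr (Quot.congr (exchangeEquiv A) fun x y => ?_)
  rw [eq_partialDual_corner_iff, ← (exchangeEquiv A).apply_eq_iff_eq (x := y) (y := across x)]
  simp only [exchangeEquiv, Equiv.coe_fn_mk, exchange_across, exchange_fst]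

theorem card_quot_along_partialDual (G : RibbonGraph E) (A : Finset E) :
    Nat.card (Quot fun x y => y = along x ∨ y = (G.partialDual A).corner x) =
      Nat.card (Quot fun x y =>
        (y = if x.1 ∈ A then across x else along x) ∨ y = G.corner x) := by
  refine Nat.card_congr (Quot.congr (exchangeEquiv A) fun x y => ?_)
  rw [eq_partialDual_corner_iff, ← (exchangeEquiv A).apply_eq_iff_eq (x := y) (y := along x)]
  simp only [exchangeEquiv, Equiv.coe_fn_mk, exchange_along, exchange_fst]

/-- Connectivity uses ends and sides symmetrically, so exchanging them has no effect. -/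
theorem numComponents_partialDual (G : RibbonGraph E) (A : Finset E) :
    (G.partialDual A).numComponents = G.numComponents := by
  refine congrArg (· + G.isolated) (Nat.card_congr (Quot.congr (exchangeEquiv A) fun x y => ?_))
  rw [eq_partialDual_corner_iff, ← (exchangeEquiv A).apply_eq_iff_eq (x := y) (y := along x),
    ← (exchangeEquiv A).apply_eq_iff_eq (x := y) (y := across x)]
  simp only [exchangeEquiv, Equiv.coe_fn_mk, exchange_along, exchange_across]
  split_ifs <;> tauto

end RibbonGraph

/-! ### Euler genus of the partial duals -/

/-- The indicator function of a set of loops of `B_{2n+1}`. -/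
def loopIndicator {n : ℕ} (A : Finset (Fin (2 * n + 1))) (v : ℕ) : Bool :=
  decide (Fin.ofNat (2 * n + 1) v ∈ A)

theorem loopIndicator_val {n : ℕ} (A : Finset (Fin (2 * n + 1))) (e : Fin (2 * n + 1)) :
    loopIndicator A e.val = decide (e ∈ A) := by
  rw [loopIndicator, ofNat_eq_mk e.isLt]

theorem isolated_bouquetB (n : ℕ) : (bouquetB n).isolated = 0 := by
  simp [bouquetB, SignedRotation.bouquet]

theorem numVertices_partialDual_bouquetB (n : ℕ) (hn : 1 ≤ n) (A : Finset (Fin (2 * n + 1))) :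
    ((bouquetB n).partialDual A).numVertices =
      numCurves (loopIndicator A 0) (Nat.count (SplitPair (loopIndicator A)) n) := by
  rw [← card_quot_sideStep n hn, numVertices, card_quot_across_partialDual]
  simp [partialDual, isolated_bouquetB, sideStep, loopIndicator_val]

theorem splitPair_not (m : ℕ → Bool) : SplitPair (fun v => !m v) = SplitPair m := by
  funext i
  simp [SplitPair]

theorem numFaces_partialDual_bouquetB (n : ℕ) (hn : 1 ≤ n) (A : Finset (Fin (2 * n + 1))) :
    ((bouquetB n).partialDual A).numFaces =
      numCurves (!loopIndicator A 0) (Nat.count (SplitPair (loopIndicator A)) n) := by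
  have h := card_quot_sideStep n hn fun v => !loopIndicator A v
  simp only [splitPair_not] at h
  rw [← h, numFaces, card_quot_along_partialDual]
  have hstep : ∀ x : Fin (2 * n + 1) × Bool × Bool, (if x.1 ∈ A then across x else along x) =
      sideStep n (fun v => !loopIndicator A v) x := by
    intro x
    by_cases hx : x.1 ∈ A <;> simp [sideStep, loopIndicator_val, hx]
  simp [partialDual, isolated_bouquetB, hstep]

theorem numComponents_bouquetB (n : ℕ) (hn : 1 ≤ n) : (bouquetB n).numComponents = 1 := by
  -- With no loop selected the only curve is the boundary of the single vertex; connectivity is a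
  -- coarser relation.
  have h := card_quot_sideStep n hn fun _ => false
  have h0 : Nat.count (SplitPair fun _ => false) n = 0 := by
    rw [Nat.count_eq_card_filter_range]
    simp [SplitPair]
  simp only [sideStep, Bool.false_eq_true, if_false, numCurves, h0, Nat.zero_add] at h
  obtain ⟨hsub, -⟩ := Nat.card_eq_one_iff_unique.1 h
  rw [numComponents, isolated_bouquetB, Nat.add_zero, Nat.card_eq_one_iff_unique]
  refine ⟨⟨?_⟩, ⟨Quot.mk _ (0, false, false)⟩⟩
  rintro ⟨x⟩ ⟨y⟩
  exact congrArg (Quot.map id fun a b hab => by tauto) (hsub.elim (Quot.mk _ x) (Quot.mk _ y))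

theorem eulerGenus_partialDual_bouquetB (n : ℕ) (hn : 1 ≤ n) (A : Finset (Fin (2 * n + 1))) :
    ((bouquetB n).partialDual A).eulerGenus =
      if Nat.count (SplitPair (loopIndicator A)) n = 0 then 2 * n + 1
      else 2 * n - 2 * Nat.count (SplitPair (loopIndicator A)) n + 2 := by
  have hle : Nat.count (SplitPair (loopIndicator A)) n ≤ n := Nat.count_le _
  rw [eulerGenus, numVertices_partialDual_bouquetB n hn, numFaces_partialDual_bouquetB n hn,
    numComponents_partialDual, numComponents_bouquetB n hn, Nat.card_fin]
  cases loopIndicator A 0 <;> simp only [numCurves, Bool.not_false, Bool.not_true, if_true,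
    Bool.false_eq_true, if_false] <;> split_ifs <;> omega

/-! ### Summation over sets of loops -/

section Counting

variable {n : ℕ}

/-- The set of loops of `B_{2n+1}` whose split pairs are those in `S`; `b` tells whether it contains
the loop `0`, and `T` which of the loops `2 * i + 1` it contains. -/
def loopSet (x : Bool × Finset (Fin n) × Finset (Fin n)) : Finset (Fin (2 * n + 1)) :=
  Finset.univ.filter fun e =>
    if h : e.val = 0 then x.1 = true
    else if e.val % 2 = 1 then (⟨(e.val - 1) / 2, by omega⟩ : Fin n) ∈ x.2.2
    else Xor (⟨(e.val - 1) / 2, by omega⟩ ∈ x.2.2) ((⟨(e.val - 1) / 2, by omega⟩ : Fin n) ∈ x.2.1)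

theorem zero_mem_loopSet (x : Bool × Finset (Fin n) × Finset (Fin n)) :
    (0 : Fin (2 * n + 1)) ∈ loopSet x ↔ x.1 = true := by
  simp [loopSet]

theorem odd_mem_loopSet (x : Bool × Finset (Fin n) × Finset (Fin n)) (i : Fin n) :
    (⟨2 * i.val + 1, by omega⟩ : Fin (2 * n + 1)) ∈ loopSet x ↔ i ∈ x.2.2 := by
  have h1 : (2 * i.val + 1) % 2 = 1 := by omega
  simp [loopSet, h1]

theorem even_mem_loopSet (x : Bool × Finset (Fin n) × Finset (Fin n)) (i : Fin n) :
    (⟨2 * i.val + 2, by omega⟩ : Fin (2 * n + 1)) ∈ loopSet x ↔ Xor (i ∈ x.2.2) (i ∈ x.2.1) := by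
  have h2 : (2 * i.val + 1) / 2 = i := by omega
  simp [loopSet, h2]

theorem loopSet_bijective : Function.Bijective (loopSet (n := n)) := by
  rw [Fintype.bijective_iff_injective_and_card]
  constructor
  · rintro x y h
    have h0 : x.1 = y.1 := by
      rw [Bool.eq_iff_iff, ← zero_mem_loopSet, h, zero_mem_loopSet]
    have hT : x.2.2 = y.2.2 := by
      ext i
      rw [← odd_mem_loopSet, h, odd_mem_loopSet]
    have hS : x.2.1 = y.2.1 := by
      ext i
      have := even_mem_loopSet x i
      rw [h, even_mem_loopSet, hT] at this
      simp only [Xor] at this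
      tauto
    exact Prod.ext h0 (Prod.ext hS hT)
  -- Both sides have `2 * 2^n * 2^n = 2^(2n+1)` elements.
  · simp
    ring

theorem count_splitPair_loopSet (x : Bool × Finset (Fin n) × Finset (Fin n)) :
    Nat.count (SplitPair (loopIndicator (loopSet x))) n = x.2.1.card := by
  have key : ∀ i : Fin n, SplitPair (loopIndicator (loopSet x)) i.val ↔ i ∈ x.2.1 := by
    intro i
    have h1 := odd_mem_loopSet x i
    have h2 := even_mem_loopSet x i
    rw [SplitPair, loopIndicator, loopIndicator, ofNat_eq_mk (by omega), ofNat_eq_mk (by omega),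
      ne_eq, decide_eq_decide, h1, h2]
    simp only [Xor]
    tauto
  rw [Nat.count_eq_card_filter_range, ← Finset.card_map Fin.valEmbedding]
  congr 1
  ext j
  simp only [Finset.mem_filter, Finset.mem_range, Finset.mem_map, Fin.valEmbedding_apply]
  constructor
  · rintro ⟨hj, h⟩
    exact ⟨⟨j, hj⟩, (key ⟨j, hj⟩).1 h, rfl⟩
  · rintro ⟨i, hi, rfl⟩
    exact ⟨i.isLt, (key i).2 hi⟩

theorem sum_loopSet_data {R : Type*} [CommRing R] (g : ℕ → R) :
    ∑ x : Bool × Finset (Fin n) × Finset (Fin n), g x.2.1.card =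
      2 ^ (n + 1) * ∑ s ∈ Finset.range (n + 1), (n.choose s : R) * g s := by
  have h := Finset.sum_powerset_apply_card g (x := (Finset.univ : Finset (Fin n)))
  simp only [Finset.powerset_univ, Finset.card_univ, Fintype.card_fin, nsmul_eq_mul] at h
  simp only [Fintype.sum_prod_type, Finset.sum_const, Finset.card_univ, Fintype.card_bool,
    Fintype.card_finset, Fintype.card_fin, nsmul_eq_mul, ← Finset.mul_sum, h]
  push_cast
  ring

theorem partialDualEulerGenusPoly_bouquetB (hn : 1 ≤ n) :
    (bouquetB n).partialDualEulerGenusPoly =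
      2 ^ (n + 1) * X ^ (2 * n + 1) +
        ∑ s ∈ Finset.Icc 1 n,
          2 ^ (n + 1) * (n.choose s : ℤ[X]) * X ^ (2 * n - 2 * s + 2) := by
  have h : (bouquetB n).partialDualEulerGenusPoly =
      ∑ x : Bool × Finset (Fin n) × Finset (Fin n),
        (X : ℤ[X]) ^ (if x.2.1.card = 0 then 2 * n + 1 else 2 * n - 2 * x.2.1.card + 2) := by
    rw [partialDualEulerGenusPoly, ← loopSet_bijective.sum_comp]
    refine Finset.sum_congr rfl fun x _ => ?_
    rw [eulerGenus_partialDual_bouquetB n hn, count_splitPair_loopSet]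
  have hI : Finset.Ico (0 + 1) (n + 1) = Finset.Icc 1 n := by
    ext
    simp only [Finset.mem_Ico, Finset.mem_Icc]
    omega
  rw [h, sum_loopSet_data fun t => (X : ℤ[X]) ^ (if t = 0 then 2 * n + 1 else 2 * n - 2 * t + 2),
    Finset.range_eq_Ico, Finset.sum_eq_sum_Ico_succ_bot (by omega), mul_add, Finset.mul_sum, hI,
    if_pos rfl, Nat.choose_zero_right, Nat.cast_one, one_mul, add_right_inj]
  refine Finset.sum_congr rfl fun s hs => ?_
  rw [Finset.mem_Icc] at hs
  rw [if_neg (by omega), mul_assoc]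

theorem coeff_partialDualEulerGenusPoly_bouquetB (hn : 1 ≤ n) (k : ℕ) :
    (bouquetB n).partialDualEulerGenusPoly.coeff k =
      (if k = 2 * n + 1 then 2 ^ (n + 1) else 0) +
        ∑ s ∈ Finset.Icc 1 n, if k = 2 * n - 2 * s + 2 then 2 ^ (n + 1) * (n.choose s : ℤ) else 0 := by
  have hC (a : ℕ) (s : ℕ) : (2 : ℤ[X]) ^ a * (s : ℤ[X]) = C (2 ^ a * (s : ℤ)) := by simp
  have hC' (a : ℕ) : (2 : ℤ[X]) ^ a = C (2 ^ a) := by simp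
  rw [partialDualEulerGenusPoly_bouquetB hn, coeff_add, finsetSum_coeff, hC', coeff_C_mul_X_pow]
  congr 1
  refine Finset.sum_congr rfl fun s _ => ?_
  rw [← hC', hC, coeff_C_mul_X_pow]

end Counting

/-! ### The gap in the exponents -/

theorem theorem3p4 (n : ℕ) (hn : 1 ≤ n) :
    (bouquetB n).partialDualEulerGenusPoly =
        2 ^ (n + 1) * X ^ (2 * n + 1) +
          ∑ s ∈ Finset.Icc 1 n,
            2 ^ (n + 1) * (n.choose s : ℤ[X]) * X ^ (2 * n - 2 * s + 2) ∧
      (2 ≤ n →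
        ¬ (bouquetB n).Orientable ∧
          (bouquetB n).partialDualEulerGenusPoly.coeff (2 * n - 1) = 0 ∧
          ¬ IsInterpolating (bouquetB n).partialDualEulerGenusPoly) := by
  refine ⟨partialDualEulerGenusPoly_bouquetB hn, fun hn2 => ?_⟩
  have hzero : (bouquetB n).partialDualEulerGenusPoly.coeff (2 * n - 1) = 0 := by
    rw [coeff_partialDualEulerGenusPoly_bouquetB hn, if_neg (by omega), zero_add]
    refine Finset.sum_eq_zero fun s hs => if_neg ?_
    rw [Finset.mem_Icc] at hs
    omega
  refine ⟨not_orientable_bouquetB n, hzero, fun h => ?_⟩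
  -- Exponent `2` comes from `s = n` and `2n + 1` from the sets without split pairs; for `n ≥ 2`
  -- they enclose `2n - 1`.
  refine h 2 (2 * n - 1) (2 * n + 1) (by omega) (by omega) (ne_of_gt ?_) (ne_of_gt ?_) hzero
  · rw [coeff_partialDualEulerGenusPoly_bouquetB hn, if_neg (by omega), zero_add]
    refine Finset.sum_pos' (fun s _ => by positivity) ⟨n, by simp [hn], ?_⟩
    rw [if_pos (by omega), Nat.choose_self]
    positivity
  · rw [coeff_partialDualEulerGenusPoly_bouquetB hn, if_pos rfl]
    exact add_pos_of_pos_of_nonneg (by positivity) (Finset.sum_nonneg fun s _ => by positivity)
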